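/- Let $\mathcal H$ be a complex Hilbert space, $H_0\ge I$ a self-adjoint operator on $\mathcal H$ with domain $\mathcal D(H_0)$, $R_0=H_0^{-1}$, $Q_0=\mathcal D(H_0^{1/2})$ and $q_0(u,u)=\|H_0^{1/2}u\|^2$ for $u\in Q_0$. Let $X$ be a symmetric sesquilinear form with form domain $Q(X)\supset\mathcal D(H_0)$. For $\varepsilon\in[0,1/2]$ let $$\|X\|_\varepsilon=\big\|R_0^{1/2+\varepsilon}XR_0^{1/2-\varepsilon}\big\|=\sup\big|X(R_0^{1/2+\varepsilon}\varphi,\,R_0^{1/2-\varepsilon}\psi)\big|\in[0,\infty],$$ the supremum over all $\varphi,\psi\in\mathcal H$ with $\|\varphi\|,\|\psi\|\le1$, $R_0^{1/2+\varepsilon}\varphi\in Q(X)$ and $R_0^{1/2-\varepsilon}\psi\in Q(X)$ (that is, over the whole unit balls if $\mathcal D(H_0^{1/2-\varepsilon})\subset Q(X)$). Let $X_0$ be the restriction of $X$ to $\mathcal D(H_0)\times\mathcal D(H_0)$. Call $X$ $q_0$-bounded if $Q_0\subset Q(X)$ and there are $a,b>0$ with $|X(u,u)|\le a\,q_0(u,u)+b\|u\|^2$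 for all $u\in Q_0$, and call an operator $T:\mathcal D(H_0)\to\mathcal H$ $H_0$-bounded if there are $a,b>0$ with $\|Tu\|\le a\|H_0u\|+b\|u\|$ for all $u\in\mathcal D(H_0)$. Then $\|X\|_\varepsilon$ is monotonically increasing (that is, nondecreasing) in $\varepsilon$, in the following sense. 1. $\varepsilon\mapsto\|X_0\|_\varepsilon\in[0,\infty]$ is nondecreasing on $[0,1/2]$; in particular this holds for $X$ itself if $Q(X)=\mathcal D(H_0)$. 2. If $Q(X)=Q_0$ and $X$ is $q_0$-bounded, then $\varepsilon\mapsto\|X\|_\varepsilon\in[0,\infty]$ is nondecreasing on $[0,1/2]$. 3. For every $X$ as above, $\varepsilon\mapsto\|X\|_\varepsilon$ is nondecreasing on the set of those $\varepsilon\in[0,1/2]$ with $\|X\|_\varepsilon<\infty$, and $\|X\|_\varepsilon=\|X_0\|_\varepsilon$ for these $\varepsilon$. It interpolates between the form-bounded case ($\varepsilon=0$) and the operator-bounded case ($\varepsilon=1/2$): 4. If $Q_0\subset Q(X)$, then $\|X\|_0<\infty$ if and only if $X$ is $q_0$-bounded. Moreover $\|X_0\|_0<\infty$ if and only if $X_0$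 is the restriction to $\mathcal D(H_0)$ of a $q_0$-bounded symmetric form with form domain $Q_0$. 5. $\|X_0\|_{1/2}<\infty$ if and only if there is an $H_0$-bounded operator $T:\mathcal D(H_0)\to\mathcal H$ with $X(u,v)=\langle Tu,v\rangle$ for all $u,v\in\mathcal D(H_0)$. For every linear operator $T:\mathcal D(H_0)\to\mathcal H$ with $X(u,v)=\langle Tu,v\rangle$ on $\mathcal D(H_0)$, bounded relative to $H_0$ or not, $\|X_0\|_{1/2}=\|TR_0\|\in[0,\infty]$. -/

import Mathlib

open scoped ENNReal ComplexConjugate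

noncomputable section

/-- A self-adjoint (possibly unbounded) operator `H₀ ≥ I` on a complex Hilbert space. -/
structure Hamiltonian (E : Type*) [NormedAddCommGroup E] [InnerProductSpace ℂ E]
    [CompleteSpace E] where
  /-- The operator, with its domain. -/
  op : E →ₗ.[ℂ] E
  isSelfAdjoint : IsSelfAdjoint op
  one_le : ∀ u : op.domain, ‖(u : E)‖ ^ 2 ≤ (inner ℂ (u : E) (op u)).re

/-- A sesquilinear form (conjugate-linear in the first variable), each variable running
through its own subspace of `E`. -/
structure SesqForm (E : Type*) [NormedAddCommGroup E] [InnerProductSpace ℂ E] where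
  left : Submodule ℂ E
  right : Submodule ℂ E
  form : left →ₗ⋆[ℂ] right →ₗ[ℂ] ℂ

/-- The norm of a sesquilinear form, in `[0, ∞]`. -/
def SesqForm.norm {E : Type*} [NormedAddCommGroup E] [InnerProductSpace ℂ E]
    (S : SesqForm E) : ℝ≥0∞ :=
  ⨆ (φ : S.left) (ψ : S.right) (_ : ‖(φ : E)‖ ≤ 1) (_ : ‖(ψ : E)‖ ≤ 1), ‖S.form φ ψ‖ₑ

/-- A symmetric quadratic form `X` with domain `Q(X)`, given by its polarization. -/
structure SymmetricForm (E : Type*) [NormedAddCommGroup E] [InnerProductSpace ℂ E] where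
  /-- The form domain `Q(X)`. -/
  domain : Submodule ℂ E
  form : domain →ₗ⋆[ℂ] domain →ₗ[ℂ] ℂ
  symm : ∀ u v : domain, conj (form u v) = form v u

namespace SymmetricForm

variable {E : Type*} [NormedAddCommGroup E] [InnerProductSpace ℂ E]

/-- The restriction of a symmetric form to a smaller domain. -/
def restrict (X : SymmetricForm E) (D : Submodule ℂ E) (h : D ≤ X.domain) :
    SymmetricForm E where
  domain := D
  form := (X.form.comp (Submodule.inclusion h)).compl₂ (Submodule.inclusion h)
  symm u v := X.symm (Submodule.inclusion h u) (Submodule.inclusion h v)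

/-- The form `A X B : (φ, ψ) ↦ X(A* φ, B ψ)` for bounded operators `A` and `B`, on the largest
domain on which the right-hand side makes sense: `A* φ ∈ Q(X)` and `B ψ ∈ Q(X)`. It is
everywhere defined if `A*` and `B` map `E` into `Q(X)`. -/
def sandwich [CompleteSpace E] (A : E →L[ℂ] E) (X : SymmetricForm E) (B : E →L[ℂ] E) :
    SesqForm E where
  left := X.domain.comap (ContinuousLinearMap.adjoint A).toLinearMap
  right := X.domain.comap B.toLinearMap
  form := (X.form.comp
    ((ContinuousLinearMap.adjoint A).toLinearMap.restrict (q := X.domain) fun _ h => h)).compl₂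
    (B.toLinearMap.restrict (q := X.domain) fun _ h => h)

end SymmetricForm

namespace Hamiltonian

variable {E : Type*} [NormedAddCommGroup E] [InnerProductSpace ℂ E] [CompleteSpace E]

theorem norm_le (H₀ : Hamiltonian E) (u : H₀.op.domain) : ‖(u : E)‖ ≤ ‖H₀.op u‖ := by
  have h1 := H₀.one_le u
  have h2 := (Complex.re_le_norm _).trans (norm_inner_le_norm (𝕜 := ℂ) (u : E) (H₀.op u))
  rcases (norm_nonneg (u : E)).eq_or_lt with h | h
  · rw [← h]; exact norm_nonneg _
  · nlinarith

theorem range_eq_top (H₀ : Hamiltonian E) : LinearMap.range H₀.op.toFun = ⊤ := by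
  have hdense := H₀.isSelfAdjoint.dense_domain
  have hcl : IsClosed (LinearMap.range H₀.op.toFun : Set E) := by
    rw [← isSeqClosed_iff_isClosed]
    intro x y hx hy
    choose u hu using hx
    have hu' : ∀ n, H₀.op (u n) = x n := hu
    have hc : CauchySeq fun n => ((u n : H₀.op.domain) : E) := by
      rw [Metric.cauchySeq_iff]
      intro ε hε
      obtain ⟨N, hN⟩ := Metric.cauchySeq_iff.1 hy.cauchySeq ε hε
      refine ⟨N, fun m hm n hn => lt_of_le_of_lt ?_ (hN m hm n hn)⟩
      have := H₀.norm_le (u m - u n)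
      rw [LinearPMap.map_sub, hu', hu'] at this
      simpa [dist_eq_norm] using this
    obtain ⟨v, hv⟩ := cauchySeq_tendsto_of_complete hc
    have hg : (v, y) ∈ H₀.op.graph := by
      refine IsClosed.mem_of_tendsto (f := fun n => (((u n : H₀.op.domain) : E), x n))
        H₀.isSelfAdjoint.isClosed (hv.prodMk_nhds hy) (Filter.Eventually.of_forall fun n => ?_)
      rw [← hu' n]
      exact LinearPMap.mem_graph _ _
    obtain ⟨w, -, hw⟩ := (LinearPMap.mem_graph_iff _).1 hg
    exact ⟨w, hw⟩
  have hclosed : (LinearMap.range H₀.op.toFun).topologicalClosure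
      = LinearMap.range H₀.op.toFun := hcl.submodule_topologicalClosure_eq
  rw [← hclosed, Submodule.topologicalClosure_eq_top_iff, Submodule.eq_bot_iff]
  intro y hy
  have h0 : ∀ u : H₀.op.domain, inner ℂ (0 : E) (u : E) = inner ℂ y (H₀.op u) := fun u => by
    rw [inner_zero_left]
    exact ((Submodule.mem_orthogonal' _ _).1 hy _ ⟨u, rfl⟩).symm
  have hmem := LinearPMap.mem_adjoint_domain_of_exists (T := H₀.op) y ⟨0, h0⟩
  have hz := LinearPMap.adjoint_apply_eq hdense ⟨y, hmem⟩ h0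
  have hsa : H₀.op.adjoint = H₀.op := H₀.isSelfAdjoint
  have hg : (y, (0 : E)) ∈ H₀.op.adjoint.graph := by
    rw [← hz]
    exact LinearPMap.mem_graph H₀.op.adjoint ⟨y, hmem⟩
  rw [hsa] at hg
  obtain ⟨w, hw, hw'⟩ := (LinearPMap.mem_graph_iff _).1 hg
  have := H₀.norm_le w
  simp only at hw hw'
  rw [hw', norm_zero, hw] at this
  exact norm_le_zero_iff.1 this

theorem bijective (H₀ : Hamiltonian E) : Function.Bijective H₀.op.toFun := by
  refine ⟨(injective_iff_map_eq_zero _).2 fun u hu => ?_, LinearMap.range_eq_top.1 H₀.range_eq_top⟩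
  have := H₀.norm_le u
  rw [show H₀.op u = 0 from hu, norm_zero] at this
  exact Subtype.ext (norm_le_zero_iff.1 this)

/-- The bounded everywhere defined operator `R₀ = H₀⁻¹`. -/
def resolvent (H₀ : Hamiltonian E) : E →L[ℂ] E :=
  (H₀.op.domain.subtype ∘ₗ
    (LinearEquiv.ofBijective H₀.op.toFun H₀.bijective).symm.toLinearMap).mkContinuous 1
    fun f => by
      obtain ⟨u, rfl⟩ := (LinearEquiv.ofBijective H₀.op.toFun H₀.bijective).surjective f
      rw [LinearMap.comp_apply, LinearEquiv.coe_coe, LinearEquiv.symm_apply_apply, one_mul]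
      exact H₀.norm_le u

/-- `R₀ ^ s`, for `s ≥ 0`, by the continuous functional calculus of bounded operators. -/
def resolventPow (H₀ : Hamiltonian E) (s : ℝ) : E →L[ℂ] E := H₀.resolvent ^ s

/-- `H₀ ^ s = (R₀ ^ s)⁻¹`, for `s ≥ 0`, with domain the range of `R₀ ^ s`. -/
def pow (H₀ : Hamiltonian E) (s : ℝ) : E →ₗ.[ℂ] E :=
  ((H₀.resolventPow s).toLinearMap.toPMap ⊤).inverse

/-- The form domain `Q₀ = D(H₀ ^ (1/2))`. -/
def formDomain (H₀ : Hamiltonian E) : Submodule ℂ E := (H₀.pow (1 / 2)).domain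

/-- The quadratic form `q₀(u, u) = ‖H₀ ^ (1/2) u‖ ^ 2` on `Q₀`. -/
def quadForm (H₀ : Hamiltonian E) (u : H₀.formDomain) : ℝ := ‖H₀.pow (1 / 2) u‖ ^ 2

/-- `‖X‖_ε = ‖R₀ ^ (1/2 + ε) X R₀ ^ (1/2 - ε)‖`, an element of `[0, ∞]`. -/
def epsNorm (H₀ : Hamiltonian E) (X : SymmetricForm E) (ε : ℝ) : ℝ≥0∞ :=
  (X.sandwich (H₀.resolventPow (1 / 2 + ε)) (H₀.resolventPow (1 / 2 - ε))).norm

/-- `X` is `q₀`-bounded. -/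
def IsFormBounded (H₀ : Hamiltonian E) (X : SymmetricForm E) : Prop :=
  ∃ h : H₀.formDomain ≤ X.domain, ∃ a > 0, ∃ b > 0, ∀ u : H₀.formDomain,
    ‖X.form (Submodule.inclusion h u) (Submodule.inclusion h u)‖
      ≤ a * H₀.quadForm u + b * ‖(u : E)‖ ^ 2

/-- The operator `T` is `H₀`-bounded. -/
def IsOperatorBounded (H₀ : Hamiltonian E) (T : E →ₗ.[ℂ] E) : Prop :=
  ∃ h : H₀.op.domain ≤ T.domain, ∃ a > 0, ∃ b > 0, ∀ u : H₀.op.domain,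
    ‖T (Submodule.inclusion h u)‖ ≤ a * ‖H₀.op u‖ + b * ‖(u : E)‖

end Hamiltonian

end

/-!
The norms of a form with domain `D(H₀)` become one inequality on all of `E` by substituting
`φ = R₀ ^ (1/2 - ε) f`, `ψ = R₀ ^ (1/2 + ε) g`: then `‖X₀‖_ε ≤ N` means
`|X(R₀ f, R₀ g)| ≤ N ‖R₀ ^ (1/2 - ε) f‖ ‖R₀ ^ (1/2 + ε) g‖` for all `f, g`
(`Hamiltonian.epsNorm_le_coe_iff_of_domain_eq`). If this holds for some `ε` and `N`, then
`X(R₀ f, R₀ g) = ⟨f, K g⟩` with `K` bounded and self-adjoint, and monotonicity is a statement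
about two bounded operators, `K` and `R₀`.

Replacing `R₀` by `a = R₀ + δ` only weakens the inequality, and `a` is invertible, so the inequality
says `F ε := ‖a ^ ε k a ^ (-ε)‖ ≤ N` with `k = a ^ (-1/2) K a ^ (-1/2)` self-adjoint. Here `F` is
continuous and even, and `F m ^ 2 ≤ F (m - h) * F (m + h)` because `‖x* x‖` is the spectral radius
of `x* x`, which does not change when two factors are swapped (`norm_rpow_conj_sq_le`). So `log F`
is convex and even, hence nondecreasing on `[0, ∞)`; this takes the place of complex
interpolation. Finally `δ → 0` (`norm_inner_le_rpow_of_nonneg`).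

Forms with larger domains reduce to `X₀` by density of the ranges of the powers of `R₀`: when
`‖X‖_ε < ∞` the form is continuous in both arguments (`Hamiltonian.epsNorm_eq_epsNorm_restrict`),
and when `X` is `q₀`-bounded it is given by a bounded operator on `Q₀`
(`Hamiltonian.epsNorm_le_epsNorm_restrict_of_isFormBounded`). The two endpoints are instances of the
Riesz representation of a form that is bounded on a dense subspace
(`exists_linearMap_inner_eq`, `exists_continuousLinearMap_inner_eq`), together with polarization.
-/

section

open scoped NNReal
open Filter Topology

/-! ### Logarithmic convexity of the norm of a conjugated operator -/

/-- The spectral radius of `a * b` is that of `b * a`; it is the norm of a self-adjoint element,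
and at most the norm of any element. -/
theorem IsSelfAdjoint.norm_mul_le_norm_mul_swap {A : Type*} [CStarAlgebra A] {a b : A}
    (h : IsSelfAdjoint (a * b)) : ‖a * b‖ ≤ ‖b * a‖ := by
  rcases subsingleton_or_nontrivial A with hA | hA
  · simp [Subsingleton.elim (a * b) 0]
  have h1 : spectralRadius ℂ (a * b) ≤ spectralRadius ℂ (b * a) := by
    refine iSup₂_le fun k hk => ?_
    rcases eq_or_ne k 0 with rfl | hk0
    · simp
    · have : k ∈ spectrum ℂ (b * a) \ {0} := by
        rw [← spectrum.nonzero_mul_comm a b]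
        exact ⟨hk, hk0⟩
      exact le_iSup₂ (f := fun k (_ : k ∈ spectrum ℂ (b * a)) => (‖k‖₊ : ℝ≥0∞)) k this.1
  have h2 := h1.trans (spectrum.spectralRadius_le_nnnorm (𝕜 := ℂ) (b * a))
  rw [h.spectralRadius_eq_nnnorm] at h2
  exact_mod_cast h2

/-- An even, continuous, log-convex function is nondecreasing on `[0, ∞)`. The hypothesis is
midpoint log-convexity, in a form that allows zeros. -/
theorem monotoneOn_Ici_of_sq_le_mul {F : ℝ → ℝ} (hc : Continuous F) (h0 : ∀ t, 0 ≤ F t)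
    (heven : ∀ t, F (-t) = F t) (hF : ∀ m h, F m ^ 2 ≤ F (m - h) * F (m + h)) :
    MonotoneOn F (Set.Ici 0) := by
  intro s hs t ht hst
  by_contra! hlt
  have hs0 : 0 ≤ s := hs
  -- If `F t < F s`, the largest maximum point `x` of `F` on `[-t, t]` is interior, and the bound
  -- for `F x ^ 2` fails for every small `h`, as `F (x + h) < F x`.
  obtain ⟨x₀, hx₀, hmax₀⟩ := (isCompact_Icc (a := -t) (b := t)).exists_isMaxOn
    ⟨s, by linarith, hst⟩ hc.continuousOn
  obtain ⟨x, ⟨hx, hMx⟩, hgr⟩ := ((isCompact_Icc (a := -t) (b := t)).inter_right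
    (isClosed_singleton.preimage hc (t := {F x₀}))).exists_isGreatest ⟨x₀, hx₀, rfl⟩
  have hMx' : F x = F x₀ := hMx
  have hle : ∀ y ∈ Set.Icc (-t) t, F y ≤ F x := fun y hy => hMx' ▸ hmax₀ hy
  have hs1 : F s ≤ F x := hle s ⟨by linarith, hst⟩
  have hxt : x ≠ t := by rintro rfl; linarith
  have hxt' : x ≠ -t := by rintro rfl; rw [heven] at hs1; linarith
  have h1 : 0 < t - x := sub_pos.2 (lt_of_le_of_ne hx.2 hxt)
  have h2 : 0 < x + t := by have := lt_of_le_of_ne hx.1 hxt'.symm; linarith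
  set h := min (t - x) (x + t) with hh
  have hpos : 0 < h := lt_min h1 h2
  have ha : h ≤ t - x := min_le_left _ _
  have hb : h ≤ x + t := min_le_right _ _
  have hp : F (x + h) < F x := by
    refine lt_of_le_of_ne (hle _ ⟨by linarith, by linarith⟩) fun he => ?_
    have := hgr (a := x + h) ⟨⟨by linarith, by linarith⟩, by
      change F (x + h) = F x₀; rw [he, hMx']⟩
    linarith
  have hm := hle (x - h) ⟨by linarith, by linarith⟩
  have := hF x h
  have hx0 : 0 < F x := (h0 _).trans_lt hp
  nlinarith [mul_le_mul_of_nonneg_right hm (h0 (x + h)), mul_lt_mul_of_pos_left hp hx0]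

section CStar
variable {A : Type*} [CStarAlgebra A] [PartialOrder A] [StarOrderedRing A]

theorem CFC.rpow_eq_exp_smul_log {a : A} (ha : IsStrictlyPositive a) (t : ℝ) :
    a ^ t = NormedSpace.exp (t • CFC.log a) := by
  have hpos : ∀ x ∈ spectrum ℝ a, 0 < x := fun x hx => by grind
  have hlog : ContinuousOn Real.log (spectrum ℝ a) :=
    Real.continuousOn_log.mono fun x hx => (hpos x hx).ne'
  rw [CFC.log, ← cfc_smul t Real.log a hlog, ← CFC.real_exp_eq_normedSpace_exp (cfc_predicate _ a),
    ← cfc_comp' Real.exp (fun x => t • Real.log x) a (by fun_prop) (hlog.const_smul t),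
    CFC.rpow_eq_cfc_real ha.nonneg]
  refine cfc_congr fun x hx => ?_
  simp [Real.rpow_def_of_pos (hpos x hx), mul_comm]

theorem CFC.continuous_rpow_right {a : A} (ha : IsStrictlyPositive a) :
    Continuous fun t : ℝ => a ^ t := by
  simp_rw [CFC.rpow_eq_exp_smul_log ha]
  let _ : NormedAlgebra ℚ A := NormedAlgebra.restrictScalars ℚ ℂ A
  exact (NormedSpace.exp_continuous (𝔸 := A)).comp (by fun_prop)

theorem CFC.rpow_add_of_nonneg {a : A} {s t : ℝ} (hs : 0 ≤ s) (ht : 0 ≤ t) :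
    a ^ (s + t) = a ^ s * a ^ t := by
  simp only [CFC.rpow_def]
  rw [← cfc_mul _ _ a (NNReal.continuous_rpow_const hs).continuousOn
    (NNReal.continuous_rpow_const ht).continuousOn]
  exact cfc_congr fun x _ => NNReal.rpow_add_of_nonneg x hs ht

theorem CFC.tendsto_add_algebraMap_rpow {a : A} {s : ℝ} (ha : 0 ≤ a) (hs : 0 ≤ s) :
    Tendsto (fun δ : ℝ≥0 => (a + algebraMap ℝ≥0 A δ) ^ s) (𝓝 0) (𝓝 (a ^ s)) := by
  have hc : Continuous fun δ : ℝ≥0 => cfc (fun x : ℝ≥0 => x ^ s) (a + algebraMap ℝ≥0 A δ) :=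
    Continuous.cfc_nnreal_of_mem_nhdsSet _ (s := Set.univ) Filter.univ_mem
      (continuous_const.add (continuous_algebraMap ℝ≥0 A))
      (fun δ => add_nonneg ha (algebraMap_nonneg A δ.2))
      (NNReal.continuous_rpow_const hs).continuousOn
  have := hc.tendsto 0
  rwa [map_zero, add_zero] at this

theorem CFC.add_algebraMap_rpow {a : A} {s : ℝ} (ha : 0 ≤ a) (hs : 0 ≤ s) (δ : ℝ≥0) :
    (a + algebraMap ℝ≥0 A δ) ^ s = cfc (fun x : ℝ≥0 => (x + δ) ^ s) a := by
  rw [CFC.rpow_def, cfc_comp' (fun x : ℝ≥0 => x ^ s) (fun x : ℝ≥0 => x + δ) a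
    (NNReal.continuous_rpow_const hs).continuousOn (by fun_prop) ha]
  congr 1
  rw [cfc_add a (fun x : ℝ≥0 => x) (fun _ => δ)]
  rw [cfc_id' ℝ≥0 a, cfc_const δ a]

/-- The function `t ↦ ‖a ^ t * k * a ^ (-t)‖` is midpoint log-convex. -/
theorem norm_rpow_conj_sq_le {a k : A} (ha : IsStrictlyPositive a) (hk : IsSelfAdjoint k)
    (m h : ℝ) : ‖a ^ m * k * a ^ (-m)‖ ^ 2 ≤
      ‖a ^ (m - h) * k * a ^ (-(m - h))‖ * ‖a ^ (m + h) * k * a ^ (-(m + h))‖ := by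
  have hu := ha.isUnit
  have hsa : ∀ t : ℝ, star (a ^ t) = a ^ t := fun t =>
    (IsSelfAdjoint.of_nonneg CFC.rpow_nonneg).star_eq
  have hstar : ∀ s t : ℝ, star (a ^ s * k * a ^ t) = a ^ t * k * a ^ s := fun s t => by
    simp only [star_mul, hsa, hk.star_eq, mul_assoc]
  -- With `x = a ^ m * k * a ^ (-m)`, the self-adjoint element `star x * x` is a product whose two
  -- factors, swapped, are the conjugates of `k` by `a ^ (m + h)` and by `a ^ (-(m - h))`.
  have hab : star (a ^ m * k * a ^ (-m)) * (a ^ m * k * a ^ (-m)) =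
      (a ^ (-m) * k * a ^ (m - h)) * (a ^ (m + h) * k * a ^ (-m)) := by
    rw [hstar]
    have : a ^ m * a ^ m = a ^ (m - h) * a ^ (m + h) := by
      rw [← CFC.rpow_add hu, ← CFC.rpow_add hu]; congr 1; ring
    calc _ = a ^ (-m) * k * (a ^ m * a ^ m) * k * a ^ (-m) := by simp only [mul_assoc]
      _ = _ := by rw [this]; simp only [mul_assoc]
  have hba : (a ^ (m + h) * k * a ^ (-m)) * (a ^ (-m) * k * a ^ (m - h)) =
      (a ^ (m + h) * k * a ^ (-(m + h))) * (a ^ (-(m - h)) * k * a ^ (m - h)) := by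
    have : a ^ (-m) * a ^ (-m) = a ^ (-(m + h)) * a ^ (-(m - h)) := by
      rw [← CFC.rpow_add hu, ← CFC.rpow_add hu]; congr 1; ring
    calc _ = a ^ (m + h) * k * (a ^ (-m) * a ^ (-m)) * k * a ^ (m - h) := by
          simp only [mul_assoc]
      _ = _ := by rw [this]; simp only [mul_assoc]
  have hs : IsSelfAdjoint ((a ^ (-m) * k * a ^ (m - h)) * (a ^ (m + h) * k * a ^ (-m))) :=
    hab ▸ IsSelfAdjoint.star_mul_self _
  rw [sq, ← CStarRing.norm_star_mul_self, hab]
  refine hs.norm_mul_le_norm_mul_swap.trans ?_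
  rw [hba, mul_comm ‖_‖]
  refine (norm_mul_le _ _).trans (le_of_eq ?_)
  rw [← norm_star (a ^ (-(m - h)) * k * a ^ (m - h)), hstar]

/-- The norm is even in `t`, as `a ^ (-t) * k * a ^ t` is the adjoint of `a ^ t * k * a ^ (-t)`. -/
theorem norm_rpow_conj_monotoneOn {a k : A} (ha : IsStrictlyPositive a) (hk : IsSelfAdjoint k) :
    MonotoneOn (fun t : ℝ => ‖a ^ t * k * a ^ (-t)‖) (Set.Ici 0) := by
  have hc := CFC.continuous_rpow_right ha
  refine monotoneOn_Ici_of_sq_le_mul ?_ (fun t => norm_nonneg _) (fun t => ?_)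
    (norm_rpow_conj_sq_le ha hk)
  · exact ((hc.mul continuous_const).mul (hc.comp continuous_neg)).norm
  · have hsa : ∀ t : ℝ, star (a ^ t) = a ^ t := fun t =>
      (IsSelfAdjoint.of_nonneg CFC.rpow_nonneg).star_eq
    rw [← norm_star]
    simp only [star_mul, hsa, hk.star_eq, mul_assoc, neg_neg]
end CStar

/-! ### Interpolation for bounded operators -/

theorem norm_le_of_forall_mem_norm_inner_le {E : Type*} [NormedAddCommGroup E]
    [InnerProductSpace ℂ E] {D : Submodule ℂ E} (hD : Dense (D : Set E)) {w : E}
    {C : ℝ} (hC : 0 ≤ C) (h : ∀ x ∈ D, ‖inner ℂ x w‖ ≤ C * ‖x‖) : ‖w‖ ≤ C := by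
  have hall : ∀ x : E, ‖inner ℂ x w‖ ≤ C * ‖x‖ := fun x =>
    hD.induction (P := fun x => ‖inner ℂ x w‖ ≤ C * ‖x‖) h
      (isClosed_le (by fun_prop) (by fun_prop)) x
  have hw := hall w
  rw [inner_self_eq_norm_sq_to_K, norm_pow, RCLike.norm_ofReal, abs_norm] at hw
  rcases (norm_nonneg w).eq_or_lt with h0 | h0
  · rwa [← h0]
  · exact le_of_mul_le_mul_right (by nlinarith) h0

section Operators
variable {E : Type*} [NormedAddCommGroup E] [InnerProductSpace ℂ E] [CompleteSpace E]

/-- Two functions `f ≤ g` of the same positive operator satisfy `f(a) ^ 2 ≤ g(a) ^ 2`, as they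
commute. -/
theorem norm_cfc_apply_le {a : E →L[ℂ] E} {f g : ℝ≥0 → ℝ≥0} (hf : Continuous f)
    (hg : Continuous g) (hfg : ∀ x, f x ≤ g x) (u : E) : ‖cfc f a u‖ ≤ ‖cfc g a u‖ := by
  have key : ∀ f : ℝ≥0 → ℝ≥0, Continuous f →
      ‖cfc f a u‖ ^ 2 = (inner ℂ u (cfc (fun x => f x * f x) a u)).re := fun f hf => by
    rw [cfc_mul f f a hf.continuousOn hf.continuousOn, mul_apply_eq_comp,
      ← ContinuousLinearMap.adjoint_inner_left, ← ContinuousLinearMap.star_eq_adjoint,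
      (IsSelfAdjoint.of_nonneg (cfc_predicate f a)).star_eq]
    exact (inner_self_eq_norm_sq (𝕜 := ℂ) _).symm
  have hle : cfc (fun x => f x * f x) a ≤ cfc (fun x => g x * g x) a :=
    cfc_mono (fun x _ => mul_le_mul' (hfg x) (hfg x)) (by fun_prop) (by fun_prop)
  rw [← sq_le_sq₀ (norm_nonneg _) (norm_nonneg _), key f hf, key g hg]
  have := ((ContinuousLinearMap.le_def _ _).1 hle).re_inner_nonneg_right u
  simpa [inner_sub_right] using this

theorem norm_rpow_apply_le {R : E →L[ℂ] E} (hR : 0 ≤ R) {s : ℝ} (hs : 0 ≤ s) (δ : ℝ≥0) (u : E) :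
    ‖(R ^ s) u‖ ≤ ‖((R + algebraMap ℝ≥0 (E →L[ℂ] E) δ) ^ s) u‖ := by
  rw [CFC.add_algebraMap_rpow hR hs]
  have hc := NNReal.continuous_rpow_const hs
  exact norm_cfc_apply_le hc (hc.comp (continuous_id.add continuous_const))
    (fun x => NNReal.rpow_le_rpow le_self_add hs) u

theorem inner_rpow_apply (a : E →L[ℂ] E) (s : ℝ) (u v : E) :
    inner ℂ ((a ^ s) u) v = inner ℂ u ((a ^ s) v) := by
  have h : star (a ^ s) = a ^ s := (IsSelfAdjoint.of_nonneg CFC.rpow_nonneg).star_eq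
  rw [← ContinuousLinearMap.adjoint_inner_right, ← ContinuousLinearMap.star_eq_adjoint, h]

/-- Interpolation between the exponents `t` and `-t`: the bound at `-t` is the one at `t` because
`K` is self-adjoint. Here `a` is invertible; see `norm_inner_le_rpow_of_nonneg` for positive `R`. -/
theorem norm_inner_le_rpow_of_isStrictlyPositive {a K : E →L[ℂ] E} (ha : IsStrictlyPositive a)
    (hK : IsSelfAdjoint K) {N s t : ℝ} (hN : 0 ≤ N) (hs : 0 ≤ s) (hst : s ≤ t)
    (h : ∀ f g, ‖inner ℂ f (K g)‖ ≤ N * ‖(a ^ (1 / 2 - t)) f‖ * ‖(a ^ (1 / 2 + t)) g‖) (f g : E) :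
    ‖inner ℂ f (K g)‖ ≤ N * ‖(a ^ (1 / 2 - s)) f‖ * ‖(a ^ (1 / 2 + s)) g‖ := by
  have hu := ha.isUnit
  have hadd : ∀ (p q : ℝ) (x : E), (a ^ p) ((a ^ q) x) = (a ^ (p + q)) x := fun p q x => by
    rw [CFC.rpow_add hu, mul_apply_eq_comp]
  have hzero : ∀ x, (a ^ (0 : ℝ)) x = x := fun x => by
    rw [CFC.rpow_zero a ha.nonneg, one_apply_eq_self]
  set k : E →L[ℂ] E := a ^ (-(1 / 2) : ℝ) * K * a ^ (-(1 / 2) : ℝ) with hk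
  have hksa : IsSelfAdjoint k := by
    have := (IsSelfAdjoint.of_nonneg (CFC.rpow_nonneg (a := a) (y := -(1 / 2)))).star_eq
    rw [IsSelfAdjoint, hk, star_mul, star_mul, this, hK.star_eq, mul_assoc]
  have hF : ∀ (r : ℝ) (x y : E), inner ℂ x ((a ^ r * k * a ^ (-r)) y) =
      inner ℂ ((a ^ (r - 1 / 2)) x) (K ((a ^ (-r - 1 / 2)) y)) := fun r x y => by
    rw [inner_rpow_apply]
    simp only [hk, mul_apply_eq_comp, hadd]
    ring_nf
  have ht : ‖a ^ t * k * a ^ (-t)‖ ≤ N := by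
    refine ContinuousLinearMap.opNorm_le_bound _ hN fun y => ?_
    refine norm_le_of_forall_mem_norm_inner_le (D := ⊤) dense_univ (by positivity) fun x _ => ?_
    rw [hF]
    refine (h _ _).trans (le_of_eq ?_)
    rw [hadd, hadd]
    ring_nf
    rw [hzero, hzero]
    ring
  have hle : ‖a ^ s * k * a ^ (-s)‖ ≤ N :=
    (norm_rpow_conj_monotoneOn ha hksa hs (hs.trans hst) hst).trans ht
  have hfg : inner ℂ f (K g) =
      inner ℂ ((a ^ (1 / 2 - s)) f) ((a ^ s * k * a ^ (-s)) ((a ^ (1 / 2 + s)) g)) := by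
    rw [hF, hadd, hadd]
    ring_nf
    rw [hzero, hzero]
  rw [hfg]
  calc _ ≤ ‖(a ^ (1 / 2 - s)) f‖ * ‖(a ^ s * k * a ^ (-s)) ((a ^ (1 / 2 + s)) g)‖ :=
        norm_inner_le_norm _ _
    _ ≤ ‖(a ^ (1 / 2 - s)) f‖ * (N * ‖(a ^ (1 / 2 + s)) g‖) := by
        gcongr
        exact ContinuousLinearMap.le_of_opNorm_le _ hle _
    _ = _ := by ring

/-- The operator form of the monotonicity: a bound for `K` relative to the powers `1/2 ∓ t` of `R`
gives the same bound relative to the powers `1/2 ∓ s`, for `0 ≤ s ≤ t ≤ 1/2`. -/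
theorem norm_inner_le_rpow_of_nonneg {R K : E →L[ℂ] E} (hR : 0 ≤ R)
    (hK : IsSelfAdjoint K) {N s t : ℝ} (hN : 0 ≤ N) (hs : 0 ≤ s) (hst : s ≤ t) (ht : t ≤ 1 / 2)
    (h : ∀ f g, ‖inner ℂ f (K g)‖ ≤ N * ‖(R ^ (1 / 2 - t)) f‖ * ‖(R ^ (1 / 2 + t)) g‖) (f g : E) :
    ‖inner ℂ f (K g)‖ ≤ N * ‖(R ^ (1 / 2 - s)) f‖ * ‖(R ^ (1 / 2 + s)) g‖ := by
  have hlim : ∀ (r : ℝ) (x : E), 0 ≤ r → Tendsto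
      (fun δ : ℝ≥0 => ‖((R + algebraMap ℝ≥0 (E →L[ℂ] E) δ) ^ r) x‖) (𝓝[>] 0) (𝓝 ‖(R ^ r) x‖) :=
    fun r x hr => (((ContinuousLinearMap.apply ℂ E x).continuous.tendsto _).comp
      ((CFC.tendsto_add_algebraMap_rpow hR hr).mono_left nhdsWithin_le_nhds)).norm
  refine ge_of_tendsto (((hlim (1 / 2 - s) f (by linarith)).const_mul N).mul
    (hlim (1 / 2 + s) g (by linarith))) ?_
  filter_upwards [self_mem_nhdsWithin] with δ hδ
  have hpos : IsStrictlyPositive (R + algebraMap ℝ≥0 (E →L[ℂ] E) δ) :=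
    by
    refine .nonneg_add hR ⟨algebraMap_nonneg _ δ.2, ?_⟩
    exact (isUnit_iff_ne_zero.2 (ne_of_gt hδ)).map _
  refine norm_inner_le_rpow_of_isStrictlyPositive hpos hK hN hs hst
    (fun f g => (h f g).trans ?_) f g
  gcongr
  · exact norm_rpow_apply_le hR (by linarith) δ f
  · exact norm_rpow_apply_le hR (by linarith) δ g

end Operators

/-! ### Representation of forms that are bounded on a dense subspace -/

section Extension
variable {E : Type*} [NormedAddCommGroup E] [InnerProductSpace ℂ E] [CompleteSpace E]
  {V : Type*} [AddCommGroup V] [Module ℂ V]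

/-- Riesz representation in the second argument. The bound may depend on the first argument, so `T`
need not be bounded. -/
theorem exists_linearMap_inner_eq {D : Submodule ℂ E} (hD : Dense (D : Set E))
    (B : V →ₗ⋆[ℂ] D →ₗ[ℂ] ℂ) (hB : ∀ x, ∃ C : ℝ, ∀ ψ : D, ‖B x ψ‖ ≤ C * ‖(ψ : E)‖) :
    ∃ T : V →ₗ[ℂ] E, ∀ x (ψ : D), B x ψ = inner ℂ (T x) (ψ : E) := by
  have hr : DenseRange D.subtype := by
    rw [DenseRange]; convert hD; ext; simp
  have hex : ∀ x, ∃ w : E, ∀ ψ : D, B x ψ = inner ℂ w (ψ : E) := fun x => by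
    refine ⟨(InnerProductSpace.toDual ℂ E).symm ((B x).extendOfNorm D.subtype), fun ψ => ?_⟩
    rw [InnerProductSpace.toDual_symm_apply]
    exact (LinearMap.extendOfNorm_eq hr (hB x) ψ).symm
  choose T hT using hex
  have huniq : ∀ w w' : E, (∀ ψ : D, inner ℂ w (ψ : E) = inner ℂ w' (ψ : E)) → w = w' :=
    fun w w' h => hD.eq_of_inner_left (𝕜 := ℂ) fun ψ hψ => h ⟨ψ, hψ⟩
  refine ⟨{ toFun := T, map_add' := fun x y => huniq _ _ fun ψ => ?_,
            map_smul' := fun c x => huniq _ _ fun ψ => ?_ }, hT⟩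
  · rw [← hT, inner_add_left, ← hT, ← hT, map_add, LinearMap.add_apply]
  · rw [← hT, RingHom.id_apply, inner_smul_left, ← hT, LinearMap.map_smulₛₗ, LinearMap.smul_apply,
      smul_eq_mul]

/-- A form that is bounded relative to a map `e` with dense range, and on a dense subspace in the
second argument, is given by a bounded operator. -/
theorem exists_continuousLinearMap_inner_eq {D : Submodule ℂ E} (hD : Dense (D : Set E))
    {e : V →ₗ[ℂ] E} (he : DenseRange e) (B : V →ₗ⋆[ℂ] D →ₗ[ℂ] ℂ) {C : ℝ} (hC : 0 ≤ C)
    (hB : ∀ x ψ, ‖B x ψ‖ ≤ C * ‖e x‖ * ‖(ψ : E)‖) :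
    ∃ M : E →L[ℂ] E, ∀ x (ψ : D), B x ψ = inner ℂ (M (e x)) (ψ : E) := by
  obtain ⟨T, hT⟩ := exists_linearMap_inner_eq hD B fun x => ⟨C * ‖e x‖, hB x⟩
  have hbd : ∀ x, ‖T x‖ ≤ C * ‖e x‖ := fun x => by
    refine norm_le_of_forall_mem_norm_inner_le hD (by positivity) fun ψ hψ => ?_
    rw [norm_inner_symm, ← hT x ⟨ψ, hψ⟩]
    exact hB x ⟨ψ, hψ⟩
  exact ⟨T.extendOfNorm e, fun x ψ => by rw [LinearMap.extendOfNorm_eq he ⟨C, hbd⟩, hT]⟩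

end Extension

namespace SymmetricForm
variable {E : Type*} [NormedAddCommGroup E] [InnerProductSpace ℂ E]

/-- Polarization. -/
theorem four_mul_form (X : SymmetricForm E) (u v : X.domain) :
    4 * X.form u v = X.form (u + v) (u + v) - X.form (u - v) (u - v)
      - Complex.I * X.form (u + Complex.I • v) (u + Complex.I • v)
      + Complex.I * X.form (u - Complex.I • v) (u - Complex.I • v) := by
  simp only [map_add, map_sub, LinearMap.add_apply, LinearMap.sub_apply, LinearMap.map_smulₛₗ,
    LinearMap.smul_apply, smul_eq_mul, Complex.conj_I, RingHom.id_apply]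
  linear_combination (2 * X.form u v - 2 * X.form v u) * Complex.I_sq

end SymmetricForm

/-! ### The resolvent and its powers -/

namespace Hamiltonian
variable {E : Type*} [NormedAddCommGroup E] [InnerProductSpace ℂ E] [CompleteSpace E]
  (H₀ : Hamiltonian E)

theorem resolvent_op (u : H₀.op.domain) : H₀.resolvent (H₀.op u) = u :=
  congrArg Subtype.val ((LinearEquiv.ofBijective H₀.op.toFun H₀.bijective).symm_apply_apply u)

/-- Every vector is in the range of `H₀`: this parametrizes `E` by `D(H₀)`, and `D(H₀)` by `E`. -/
theorem exists_op_eq (f : E) : ∃ u : H₀.op.domain, H₀.op u = f ∧ (u : E) = H₀.resolvent f := by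
  obtain ⟨u, rfl⟩ := H₀.bijective.2 f
  exact ⟨u, rfl, (H₀.resolvent_op u).symm⟩

theorem resolvent_mem_domain (f : E) : H₀.resolvent f ∈ H₀.op.domain := by
  obtain ⟨u, -, hu⟩ := H₀.exists_op_eq f
  exact hu ▸ u.2

theorem inner_op_eq (u v : H₀.op.domain) :
    inner ℂ (H₀.op u) (v : E) = inner ℂ (u : E) (H₀.op v) := by
  have h := LinearPMap.adjoint_isFormalAdjoint H₀.isSelfAdjoint.dense_domain
  rw [show H₀.op.adjoint = H₀.op from H₀.isSelfAdjoint] at h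
  exact h u v

theorem resolvent_nonneg : 0 ≤ H₀.resolvent := by
  rw [ContinuousLinearMap.nonneg_iff_isPositive, ContinuousLinearMap.isPositive_def]
  refine ⟨fun f g => ?_, fun f => ?_⟩
  · obtain ⟨u, rfl, -⟩ := H₀.exists_op_eq f
    obtain ⟨v, rfl, -⟩ := H₀.exists_op_eq g
    simp only [ContinuousLinearMap.coe_coe, resolvent_op]
    exact (H₀.inner_op_eq u v).symm
  · obtain ⟨u, rfl, -⟩ := H₀.exists_op_eq f
    rw [ContinuousLinearMap.reApplyInnerSelf_apply, resolvent_op]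
    exact (sq_nonneg _).trans (H₀.one_le u)

theorem resolvent_injective : Function.Injective H₀.resolvent := by
  intro f g h
  obtain ⟨u, rfl, -⟩ := H₀.exists_op_eq f
  obtain ⟨v, rfl, -⟩ := H₀.exists_op_eq g
  rw [resolvent_op, resolvent_op] at h
  rw [Subtype.ext h]

theorem resolventPow_resolventPow {s t : ℝ} (hs : 0 ≤ s) (ht : 0 ≤ t) (f : E) :
    H₀.resolventPow s (H₀.resolventPow t f) = H₀.resolventPow (s + t) f := by
  simp only [resolventPow]
  rw [CFC.rpow_add_of_nonneg hs ht, mul_apply_eq_comp]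

theorem resolventPow_zero (f : E) : H₀.resolventPow 0 f = f := by
  rw [resolventPow, CFC.rpow_zero _ H₀.resolvent_nonneg, one_apply_eq_self]

theorem resolventPow_one : H₀.resolventPow 1 = H₀.resolvent :=
  CFC.rpow_one _ H₀.resolvent_nonneg

theorem resolventPow_comp_eq_resolvent {s t : ℝ} (hs : 0 ≤ s) (ht : 0 ≤ t) (h : s + t = 1) (f : E) :
    H₀.resolventPow s (H₀.resolventPow t f) = H₀.resolvent f := by
  rw [resolventPow_resolventPow _ hs ht, h, resolventPow_one]

theorem adjoint_resolventPow (s : ℝ) :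
    ContinuousLinearMap.adjoint (H₀.resolventPow s) = H₀.resolventPow s := by
  rw [← ContinuousLinearMap.star_eq_adjoint]
  exact (IsSelfAdjoint.of_nonneg CFC.rpow_nonneg).star_eq

theorem resolventPow_injective {s : ℝ} (hs : 0 ≤ s) (hs1 : s ≤ 1) :
    Function.Injective (H₀.resolventPow s) := fun f g h => H₀.resolvent_injective <| by
  rw [← H₀.resolventPow_comp_eq_resolvent (sub_nonneg.2 hs1) hs (by ring), h,
    H₀.resolventPow_comp_eq_resolvent (sub_nonneg.2 hs1) hs (by ring)]

/-- The orthogonal complement of the range is the kernel, as the power is self-adjoint. -/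
theorem denseRange_resolventPow {s : ℝ} (hs : 0 ≤ s) (hs1 : s ≤ 1) :
    DenseRange (H₀.resolventPow s) := by
  have h : (LinearMap.range (H₀.resolventPow s).toLinearMap)ᗮ = ⊥ := by
    have := ContinuousLinearMap.orthogonal_range (H₀.resolventPow s)
    rw [adjoint_resolventPow] at this
    rw [this]
    exact LinearMap.ker_eq_bot.2 (H₀.resolventPow_injective hs hs1)
  exact Submodule.dense_iff_topologicalClosure_eq_top.2
    ((Submodule.topologicalClosure_eq_top_iff (K := LinearMap.range _)).2 h)

/-- Injectivity of `R₀ ^ s`, in the form that makes `H₀ ^ s`, a `LinearPMap.inverse`, a true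
inverse. -/
theorem ker_resolventPow_toPMap {s : ℝ} (hs : 0 ≤ s) (hs1 : s ≤ 1) :
    LinearMap.ker ((H₀.resolventPow s).toLinearMap.toPMap ⊤).toFun = ⊥ :=
  LinearMap.ker_eq_bot.2 fun _ _ h => Subtype.ext (H₀.resolventPow_injective hs hs1 h)

theorem mem_formDomain_iff {x : E} : x ∈ H₀.formDomain ↔ ∃ f, H₀.resolventPow (1 / 2) f = x := by
  rw [formDomain, pow, LinearPMap.inverse_domain, LinearMap.mem_range]
  exact ⟨fun ⟨f, hf⟩ => ⟨f, hf⟩, fun ⟨f, hf⟩ => ⟨⟨f, trivial⟩, hf⟩⟩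

theorem pow_half_apply {f : E} {u : H₀.formDomain} (h : (u : E) = H₀.resolventPow (1 / 2) f) :
    H₀.pow (1 / 2) u = f :=
  LinearPMap.inverse_apply_eq (H₀.ker_resolventPow_toPMap (by norm_num) (by norm_num))
    (x := ⟨f, trivial⟩) h.symm

theorem quadForm_eq {f : E} {u : H₀.formDomain} (h : (u : E) = H₀.resolventPow (1 / 2) f) :
    H₀.quadForm u = ‖f‖ ^ 2 := by
  rw [quadForm, H₀.pow_half_apply h]

theorem domain_le_formDomain : H₀.op.domain ≤ H₀.formDomain := fun x hx => by
  refine H₀.mem_formDomain_iff.2 ⟨H₀.resolventPow (1 / 2) (H₀.op ⟨x, hx⟩), ?_⟩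
  rw [H₀.resolventPow_comp_eq_resolvent (by norm_num) (by norm_num) (by norm_num), resolvent_op]

/-! ### The norms `‖X‖_ε` as bounds -/

variable {H₀} {X : SymmetricForm E}

/-- The vectors `R₀ ^ (1/2 + ε) φ` and `R₀ ^ (1/2 - ε) ψ` enter as elements `u`, `v` of `Q(X)`
with equations, which is how all bounds on forms are stated below. -/
theorem epsNorm_le_iff {ε : ℝ} {N : ℝ≥0∞} : H₀.epsNorm X ε ≤ N ↔
    ∀ (φ ψ : E) (u v : X.domain), (u : E) = H₀.resolventPow (1 / 2 + ε) φ →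
      (v : E) = H₀.resolventPow (1 / 2 - ε) ψ → ‖φ‖ ≤ 1 → ‖ψ‖ ≤ 1 → ‖X.form u v‖ₑ ≤ N := by
  simp only [epsNorm, SesqForm.norm, iSup_le_iff]
  constructor
  · intro h φ ψ u v hu hv hφ hψ
    have hu' : (u : E) = ContinuousLinearMap.adjoint (H₀.resolventPow (1 / 2 + ε)) φ := by
      rw [adjoint_resolventPow, hu]
    have := h ⟨φ, show _ ∈ X.domain from hu' ▸ u.2⟩ ⟨ψ, show _ ∈ X.domain from hv ▸ v.2⟩ hφ hψ
    rw [show u = ⟨_, hu' ▸ u.2⟩ from Subtype.ext hu', show v = ⟨_, hv ▸ v.2⟩ from Subtype.ext hv]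
    exact this
  · intro h φ ψ hφ hψ
    refine h φ ψ ⟨_, φ.2⟩ ⟨_, ψ.2⟩ ?_ rfl hφ hψ
    change ContinuousLinearMap.adjoint (H₀.resolventPow _) (φ : E) = _
    rw [adjoint_resolventPow]

/-- The homogeneous version of `epsNorm_le_iff`. -/
theorem epsNorm_le_coe_iff {ε : ℝ} {N : ℝ≥0} : H₀.epsNorm X ε ≤ N ↔
    ∀ (φ ψ : E) (u v : X.domain), (u : E) = H₀.resolventPow (1 / 2 + ε) φ →
      (v : E) = H₀.resolventPow (1 / 2 - ε) ψ → ‖X.form u v‖ ≤ N * ‖φ‖ * ‖ψ‖ := by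
  have hcoe : ∀ z : ℂ, ‖z‖ₑ ≤ N ↔ ‖z‖ ≤ N := fun z => by
    rw [← ofReal_norm, ENNReal.ofReal_le_iff_le_toReal ENNReal.coe_ne_top,
      ENNReal.coe_toReal]
  rw [epsNorm_le_iff]
  simp only [hcoe]
  constructor
  · intro h φ ψ u v hu hv
    rcases eq_or_ne φ 0 with rfl | hφ
    · have : u = 0 := Subtype.ext (by simpa using hu)
      simp [this]
    rcases eq_or_ne ψ 0 with rfl | hψ
    · have : v = 0 := Subtype.ext (by simpa using hv)
      simp [this]
    have hφ' := norm_pos_iff.2 hφ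
    have hψ' := norm_pos_iff.2 hψ
    have := h (((‖φ‖⁻¹ : ℝ) : ℂ) • φ) (((‖ψ‖⁻¹ : ℝ) : ℂ) • ψ) (((‖φ‖⁻¹ : ℝ) : ℂ) • u)
      (((‖ψ‖⁻¹ : ℝ) : ℂ) • v) (by simp [hu]) (by simp [hv])
      (by simp [norm_smul, hφ]) (by simp [norm_smul, hψ])
    simp only [map_smulₛₗ, LinearMap.smul_apply, norm_smul, RingHom.id_apply, Complex.conj_ofReal,
      Complex.norm_real, norm_inv, norm_norm] at this
    rw [← div_le_iff₀ hψ', ← div_le_iff₀ hφ']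
    refine (le_of_eq ?_).trans this
    ring
  · intro h φ ψ u v hu hv hφ hψ
    refine (h φ ψ u v hu hv).trans ?_
    calc (N : ℝ) * ‖φ‖ * ‖ψ‖ ≤ N * 1 * 1 := by gcongr
      _ = N := by ring

end Hamiltonian

/-! ### Monotonicity, and the form bounded case -/

namespace Hamiltonian
variable {E : Type*} [NormedAddCommGroup E] [InnerProductSpace ℂ E] [CompleteSpace E]
  {H₀ : Hamiltonian E} {X Y : SymmetricForm E}

/-- For a form with domain `D(H₀)` the vectors that enter `‖Y‖_ε` are exactly
`φ = R₀ ^ (1/2 - ε) f` and `ψ = R₀ ^ (1/2 + ε) g`, with `f` and `g` arbitrary. -/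
theorem epsNorm_le_coe_iff_of_domain_eq (hY : Y.domain = H₀.op.domain) {ε : ℝ}
    (hε : ε ∈ Set.Icc (0 : ℝ) (1 / 2)) {N : ℝ≥0} : H₀.epsNorm Y ε ≤ N ↔
    ∀ (f g : E) (u v : Y.domain), (u : E) = H₀.resolvent f → (v : E) = H₀.resolvent g →
      ‖Y.form u v‖ ≤ N * ‖H₀.resolventPow (1 / 2 - ε) f‖ * ‖H₀.resolventPow (1 / 2 + ε) g‖ := by
  obtain ⟨h0, h1⟩ := hε
  have hp : 0 ≤ 1 / 2 + ε := by linarith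
  have hm : 0 ≤ 1 / 2 - ε := by linarith
  rw [epsNorm_le_coe_iff]
  constructor
  · intro h f g u v hu hv
    refine h _ _ u v ?_ ?_
    · rw [hu, H₀.resolventPow_comp_eq_resolvent hp hm (by ring)]
    · rw [hv, H₀.resolventPow_comp_eq_resolvent hm hp (by ring)]
  · intro h φ ψ u v hu hv
    have hex : ∀ w : Y.domain, ∃ f, (w : E) = H₀.resolvent f := fun w =>
      ⟨H₀.op ⟨w, hY ▸ w.2⟩, (H₀.resolvent_op ⟨w, hY ▸ w.2⟩).symm⟩
    obtain ⟨f, hf⟩ := hex u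
    obtain ⟨g, hg⟩ := hex v
    have hφ : φ = H₀.resolventPow (1 / 2 - ε) f :=
      H₀.resolventPow_injective hp (by linarith) (by
        rw [← hu, hf, H₀.resolventPow_comp_eq_resolvent hp hm (by ring)])
    have hψ : ψ = H₀.resolventPow (1 / 2 + ε) g :=
      H₀.resolventPow_injective hm (by linarith) (by
        rw [← hv, hg, H₀.resolventPow_comp_eq_resolvent hm hp (by ring)])
    rw [hφ, hψ]
    exact h f g u v hf hg

/-- A symmetric form whose pullback along `A` is bounded is given by a bounded self-adjoint
operator there. It is used with `A = R₀` and `A = R₀ ^ (1/2)`. -/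
theorem exists_isSelfAdjoint_form_eq (A : E →L[ℂ] E) (hA : ∀ f, A f ∈ X.domain) {C : ℝ}
    (hC : 0 ≤ C) (h : ∀ (f g : E) (u v : X.domain), (u : E) = A f → (v : E) = A g →
      ‖X.form u v‖ ≤ C * ‖f‖ * ‖g‖) :
    ∃ K : E →L[ℂ] E, IsSelfAdjoint K ∧ ∀ (f g : E) (u v : X.domain),
      (u : E) = A f → (v : E) = A g → X.form u v = inner ℂ f (K g) := by
  let A' : E →ₗ[ℂ] X.domain := A.toLinearMap.codRestrict X.domain hA
  obtain ⟨K, hK⟩ := exists_continuousLinearMap_inner_eq (D := (⊤ : Submodule ℂ E)) dense_univ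
    (e := LinearMap.id) Function.surjective_id.denseRange
    ((X.form.comp A').compl₂ (A' ∘ₗ Submodule.subtype _)) hC
    (fun f g => h f g _ _ rfl rfl)
  have hK' : ∀ (f g : E) (u v : X.domain), (u : E) = A f → (v : E) = A g →
      X.form u v = inner ℂ (K f) g := fun f g u v hu hv => by
    rw [show u = A' f from Subtype.ext hu, show v = A' g from Subtype.ext hv]
    exact hK f ⟨g, trivial⟩
  have hsymm : ∀ f g, inner ℂ (K f) g = inner ℂ f (K g) := fun f g => by
    rw [← hK' f g ⟨A f, hA f⟩ ⟨A g, hA g⟩ rfl rfl, ← X.symm,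
      hK' g f ⟨A g, hA g⟩ ⟨A f, hA f⟩ rfl rfl, inner_conj_symm]
  exact ⟨K, ContinuousLinearMap.isSelfAdjoint_iff_isSymmetric.2 hsymm,
    fun f g u v hu hv => by rw [hK' f g u v hu hv, hsymm]⟩

/-- Monotonicity for a form with domain `D(H₀)`. Finiteness at the larger parameter makes
`(f, g) ↦ Y(R₀ f, R₀ g)` bounded, which gives the operator `K`. -/
theorem monotoneOn_epsNorm_of_domain_eq (hY : Y.domain = H₀.op.domain) :
    MonotoneOn (H₀.epsNorm Y) (Set.Icc 0 (1 / 2)) := by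
  intro s hs t ht hst
  rcases eq_or_ne (H₀.epsNorm Y t) ∞ with htop | htop
  · rw [htop]; exact le_top
  obtain ⟨N, hN⟩ : ∃ N : ℝ≥0, N = H₀.epsNorm Y t := ⟨_, ENNReal.coe_toNNReal htop⟩
  have hb := (epsNorm_le_coe_iff_of_domain_eq hY ht).1 hN.ge
  rw [← hN, epsNorm_le_coe_iff_of_domain_eq hY hs]
  have hA : ∀ f, H₀.resolvent f ∈ Y.domain := fun f => hY ▸ H₀.resolvent_mem_domain f
  obtain ⟨K, hKsa, hK⟩ := exists_isSelfAdjoint_form_eq H₀.resolvent hA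
    (C := N * ‖H₀.resolventPow (1 / 2 - t)‖ * ‖H₀.resolventPow (1 / 2 + t)‖) (by positivity)
    (fun f g u v hu hv => (hb f g u v hu hv).trans (by
      calc _ ≤ (N : ℝ) * (‖H₀.resolventPow (1 / 2 - t)‖ * ‖f‖) *
            (‖H₀.resolventPow (1 / 2 + t)‖ * ‖g‖) := by
            gcongr <;> exact ContinuousLinearMap.le_opNorm _ _
        _ = _ := by ring))
  intro f g u v hu hv
  rw [hK f g u v hu hv]
  refine norm_inner_le_rpow_of_nonneg H₀.resolvent_nonneg hKsa N.2 hs.1 hst ht.2 (fun f g => ?_) f g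
  rw [← hK f g ⟨_, hA f⟩ ⟨_, hA g⟩ rfl rfl]
  exact hb f g _ _ rfl rfl

theorem epsNorm_restrict_le {D : Submodule ℂ E} (hD : D ≤ X.domain) (ε : ℝ) :
    H₀.epsNorm (X.restrict D hD) ε ≤ H₀.epsNorm X ε :=
  epsNorm_le_iff.2 fun φ ψ u v hu hv hφ hψ => epsNorm_le_iff.1 le_rfl φ ψ
    (Submodule.inclusion hD u) (Submodule.inclusion hD v) hu hv hφ hψ

/-- The bound of `epsNorm_le_coe_iff_of_domain_eq` for the restriction of `X` to `D(H₀)`, with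
arguments in `Q(X)`. -/
theorem norm_form_resolvent_le (hX : H₀.op.domain ≤ X.domain) {ε : ℝ}
    (hε : ε ∈ Set.Icc (0 : ℝ) (1 / 2)) {N : ℝ≥0}
    (h : H₀.epsNorm (X.restrict H₀.op.domain hX) ε ≤ N) (f g : E) (u v : X.domain)
    (hu : (u : E) = H₀.resolvent f) (hv : (v : E) = H₀.resolvent g) :
    ‖X.form u v‖ ≤ N * ‖H₀.resolventPow (1 / 2 - ε) f‖ * ‖H₀.resolventPow (1 / 2 + ε) g‖ :=
  (epsNorm_le_coe_iff_of_domain_eq (Y := X.restrict H₀.op.domain hX) rfl hε).1 h f g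
    ⟨u, hu ▸ H₀.resolvent_mem_domain f⟩ ⟨v, hv ▸ H₀.resolvent_mem_domain g⟩ hu hv

/-- If `‖X‖_ε` is finite, the sandwiched form is continuous in `φ` and `ψ`, so its norm is
determined by the dense ranges of `R₀ ^ (1/2 - ε)` and `R₀ ^ (1/2 + ε)`. -/
theorem epsNorm_eq_epsNorm_restrict (hX : H₀.op.domain ≤ X.domain) {ε : ℝ}
    (hε : ε ∈ Set.Icc (0 : ℝ) (1 / 2)) (hfin : H₀.epsNorm X ε < ∞) :
    H₀.epsNorm X ε = H₀.epsNorm (X.restrict H₀.op.domain hX) ε := by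
  refine le_antisymm ?_ (epsNorm_restrict_le hX ε)
  have hp : 0 ≤ 1 / 2 + ε := by linarith [hε.1]
  have hm : 0 ≤ 1 / 2 - ε := by linarith [hε.2]
  obtain ⟨N, hN⟩ : ∃ N : ℝ≥0, N = H₀.epsNorm X ε := ⟨_, ENNReal.coe_toNNReal hfin.ne⟩
  obtain ⟨N₀, hN₀⟩ : ∃ N : ℝ≥0, N = H₀.epsNorm (X.restrict H₀.op.domain hX) ε :=
    ⟨_, ENNReal.coe_toNNReal ((epsNorm_restrict_le hX ε).trans_lt hfin).ne⟩
  have hb := epsNorm_le_coe_iff.1 hN.ge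
  have hb₀ := norm_form_resolvent_le hX hε hN₀.ge
  rw [← hN₀, epsNorm_le_coe_iff]
  intro φ ψ u v hu hv
  have hseq : ∀ s : ℝ, 0 ≤ s → s ≤ 1 → ∀ x : E, ∃ f : ℕ → E,
      Tendsto (fun n => H₀.resolventPow s (f n)) atTop (𝓝 x) := fun s h0 h1 x => by
    obtain ⟨y, hy, hlim⟩ := mem_closure_iff_seq_limit.1 (H₀.denseRange_resolventPow h0 h1 x)
    choose f hf using hy
    exact ⟨f, by simpa only [hf] using hlim⟩
  obtain ⟨f, hf⟩ := hseq (1 / 2 - ε) hm (by linarith [hε.1]) φ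
  obtain ⟨g, hg⟩ := hseq (1 / 2 + ε) hp (by linarith [hε.2]) ψ
  set φ' := fun n => H₀.resolventPow (1 / 2 - ε) (f n)
  set ψ' := fun n => H₀.resolventPow (1 / 2 + ε) (g n)
  have hlim : Tendsto (fun n => N * ‖φ - φ' n‖ * ‖ψ‖ + N * ‖φ' n‖ * ‖ψ - ψ' n‖
      + N₀ * ‖φ' n‖ * ‖ψ' n‖) atTop (𝓝 (N * ‖φ - φ‖ * ‖ψ‖ + N * ‖φ‖ * ‖ψ - ψ‖
      + N₀ * ‖φ‖ * ‖ψ‖)) :=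
    ((((tendsto_const_nhds.sub hf).norm.const_mul _).mul_const _).add
      ((hf.norm.const_mul _).mul (tendsto_const_nhds.sub hg).norm)).add
      ((hf.norm.const_mul _).mul hg.norm)
  simp only [sub_self, norm_zero, mul_zero, zero_mul, zero_add] at hlim
  refine ge_of_tendsto' hlim fun n => ?_
  let u' : X.domain := ⟨H₀.resolvent (f n), hX (H₀.resolvent_mem_domain _)⟩
  let v' : X.domain := ⟨H₀.resolvent (g n), hX (H₀.resolvent_mem_domain _)⟩
  have hu' : (u' : E) = H₀.resolventPow (1 / 2 + ε) (φ' n) :=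
    (H₀.resolventPow_comp_eq_resolvent hp hm (by ring) _).symm
  have hv' : (v' : E) = H₀.resolventPow (1 / 2 - ε) (ψ' n) :=
    (H₀.resolventPow_comp_eq_resolvent hm hp (by ring) _).symm
  have hsplit : X.form u v = X.form (u - u') v + X.form u' (v - v') + X.form u' v' := by
    simp only [map_sub, LinearMap.sub_apply]; ring
  rw [hsplit]
  refine norm_add₃_le.trans (add_le_add_three ?_ ?_ ?_)
  · exact hb _ _ _ _ (by rw [map_sub, ← hu, ← hu']; rfl) hv
  · exact hb _ _ _ _ hu' (by rw [map_sub, ← hv, ← hv']; rfl)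
  · exact hb₀ _ _ _ _ rfl rfl

theorem epsNorm_zero_le_coe_iff {N : ℝ≥0} : H₀.epsNorm X 0 ≤ N ↔
    ∀ (f g : E) (u v : X.domain), (u : E) = H₀.resolventPow (1 / 2) f →
      (v : E) = H₀.resolventPow (1 / 2) g → ‖X.form u v‖ ≤ N * ‖f‖ * ‖g‖ := by
  rw [epsNorm_le_coe_iff, add_zero, sub_zero]

/-- On `u = R₀ ^ (1/2) f` the form bound is a bound by `‖f‖ ^ 2`; polarization does the rest. -/
theorem IsFormBounded.epsNorm_zero_lt_top (h : H₀.IsFormBounded X) : H₀.epsNorm X 0 < ∞ := by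
  obtain ⟨hX, a, ha, b, hb, h⟩ := h
  set c : ℝ := a + b * ‖H₀.resolventPow (1 / 2)‖ ^ 2 with hc
  have hdiag : ∀ (f : E) (u : X.domain), (u : E) = H₀.resolventPow (1 / 2) f →
      ‖X.form u u‖ ≤ c * ‖f‖ ^ 2 := fun f u hu => by
    let u₀ : H₀.formDomain := ⟨u, H₀.mem_formDomain_iff.2 ⟨f, hu.symm⟩⟩
    have h1 := h u₀
    rw [H₀.quadForm_eq (u := u₀) hu] at h1
    have h2 : ‖(u₀ : E)‖ ≤ ‖H₀.resolventPow (1 / 2)‖ * ‖f‖ :=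
      (congrArg norm hu).trans_le (ContinuousLinearMap.le_opNorm _ _)
    calc ‖X.form u u‖ ≤ a * ‖f‖ ^ 2 + b * ‖(u₀ : E)‖ ^ 2 := h1
      _ ≤ a * ‖f‖ ^ 2 + b * (‖H₀.resolventPow (1 / 2)‖ * ‖f‖) ^ 2 := by gcongr
      _ = c * ‖f‖ ^ 2 := by rw [hc]; ring
  have hc0 : 0 ≤ c := by positivity
  refine lt_of_le_of_lt (b := ENNReal.ofReal (4 * c)) (epsNorm_le_iff.2 ?_) ENNReal.ofReal_lt_top
  intro f g u v hu hv hf hg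
  rw [add_zero] at hu
  rw [sub_zero] at hv
  rw [← ofReal_norm]
  refine ENNReal.ofReal_le_ofReal ?_
  have hbd : ∀ (k : E) (w : X.domain), (w : E) = H₀.resolventPow (1 / 2) k → ‖k‖ ≤ 2 →
      ‖X.form w w‖ ≤ 4 * c := fun k w hw hk =>
    (hdiag k w hw).trans (by
      nlinarith [mul_le_mul_of_nonneg_left (pow_le_pow_left₀ (norm_nonneg k) hk 2) hc0])
  have hg' : ‖Complex.I • g‖ ≤ 1 := by rwa [norm_smul, Complex.norm_I, one_mul]
  have h1 := hbd (f + g) (u + v) (by simp [hu, hv]) ((norm_add_le _ _).trans (by linarith))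
  have h2 := hbd (f - g) (u - v) (by simp [hu, hv]) ((norm_sub_le _ _).trans (by linarith))
  have h3 := hbd (f + Complex.I • g) (u + Complex.I • v) (by simp [hu, hv])
    ((norm_add_le _ _).trans (by linarith))
  have h4 := hbd (f - Complex.I • g) (u - Complex.I • v) (by simp [hu, hv])
    ((norm_sub_le _ _).trans (by linarith))
  have hpol := congrArg norm (X.four_mul_form u v)
  rw [norm_mul, RCLike.norm_ofNat] at hpol
  have htri := (norm_add_le (X.form (u + v) (u + v) - X.form (u - v) (u - v)
      - Complex.I * X.form (u + Complex.I • v) (u + Complex.I • v))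
      (Complex.I * X.form (u - Complex.I • v) (u - Complex.I • v))).trans
    (add_le_add_left ((norm_sub_le _ _).trans (add_le_add_left (norm_sub_le _ _) _)) _)
  rw [norm_mul, norm_mul, Complex.norm_I, one_mul, one_mul] at htri
  linarith

theorem epsNorm_zero_lt_top_iff (hX : H₀.formDomain ≤ X.domain) :
    H₀.epsNorm X 0 < ∞ ↔ H₀.IsFormBounded X := by
  refine ⟨fun hlt => ?_, IsFormBounded.epsNorm_zero_lt_top⟩
  obtain ⟨N, hN⟩ : ∃ N : ℝ≥0, N = H₀.epsNorm X 0 := ⟨_, ENNReal.coe_toNNReal hlt.ne⟩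
  refine ⟨hX, N + 1, by positivity, 1, one_pos, fun u => ?_⟩
  obtain ⟨f, hf⟩ := H₀.mem_formDomain_iff.1 u.2
  rw [H₀.quadForm_eq hf.symm]
  have := epsNorm_zero_le_coe_iff.1 hN.ge f f (Submodule.inclusion hX u)
    (Submodule.inclusion hX u) hf.symm hf.symm
  nlinarith [sq_nonneg ‖f‖, sq_nonneg ‖(u : E)‖]

theorem IsFormBounded.exists_norm_le (h : H₀.IsFormBounded X) :
    ∃ N : ℝ≥0, ∀ (f g : E) (u v : X.domain), (u : E) = H₀.resolventPow (1 / 2) f →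
      (v : E) = H₀.resolventPow (1 / 2) g → ‖X.form u v‖ ≤ N * ‖f‖ * ‖g‖ :=
  ⟨_, epsNorm_zero_le_coe_iff.1 (ENNReal.coe_toNNReal h.epsNorm_zero_lt_top.ne).ge⟩

/-- A `q₀`-bounded form is `(P f, P g) ↦ ⟨f, K g⟩` on `Q₀`, with `P = R₀ ^ (1/2)` and `K` bounded.
This continuity in `f` and `g` lets the bound on `D(H₀)` pass to `Q₀` even when nothing is known
about `‖X‖_ε`. -/
theorem epsNorm_le_epsNorm_restrict_of_isFormBounded (hX : H₀.op.domain ≤ X.domain)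
    (hdom : X.domain = H₀.formDomain) (hb : H₀.IsFormBounded X) {ε : ℝ}
    (hε : ε ∈ Set.Icc (0 : ℝ) (1 / 2)) :
    H₀.epsNorm X ε ≤ H₀.epsNorm (X.restrict H₀.op.domain hX) ε := by
  have hp : 0 ≤ 1 / 2 + ε := by linarith [hε.1]
  have hm : 0 ≤ 1 / 2 - ε := by linarith [hε.2]
  rcases eq_or_ne (H₀.epsNorm (X.restrict H₀.op.domain hX) ε) ∞ with htop | htop
  · rw [htop]; exact le_top
  obtain ⟨N, hN⟩ : ∃ N : ℝ≥0, N = H₀.epsNorm (X.restrict H₀.op.domain hX) ε :=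
    ⟨_, ENNReal.coe_toNNReal htop⟩
  have hb₀ := norm_form_resolvent_le hX hε hN.ge
  obtain ⟨C, hC⟩ := hb.exists_norm_le
  have hmem : ∀ f, H₀.resolventPow (1 / 2) f ∈ X.domain := fun f =>
    hdom.ge (H₀.mem_formDomain_iff.2 ⟨f, rfl⟩)
  obtain ⟨K, -, hK⟩ := exists_isSelfAdjoint_form_eq (H₀.resolventPow (1 / 2)) hmem C.2 hC
  -- `R₀ ^ (1/2 - ε) ψ` lies in `Q₀` exactly when `ψ = R₀ ^ ε g` for some `g`.
  have hKb : ∀ φ g : E, ‖inner ℂ (H₀.resolventPow ε φ) (K g)‖ ≤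
      N * ‖φ‖ * ‖H₀.resolventPow ε g‖ := by
    intro φ g
    refine (H₀.denseRange_resolventPow hm (by linarith [hε.1])).induction_on
      (p := fun φ => ‖inner ℂ (H₀.resolventPow ε φ) (K g)‖ ≤ N * ‖φ‖ * ‖H₀.resolventPow ε g‖) φ
      (isClosed_le (by fun_prop) (by fun_prop)) fun f => ?_
    refine (H₀.denseRange_resolventPow (s := 1 / 2) (by norm_num) (by norm_num)).induction_on
      (p := fun g => ‖inner ℂ (H₀.resolventPow ε (H₀.resolventPow (1 / 2 - ε) f)) (K g)‖ ≤
        N * ‖H₀.resolventPow (1 / 2 - ε) f‖ * ‖H₀.resolventPow ε g‖) g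
      (isClosed_le (by fun_prop) (by fun_prop)) fun h => ?_
    rw [H₀.resolventPow_resolventPow hε.1 hm, H₀.resolventPow_resolventPow hε.1 (by norm_num),
      add_sub_cancel, add_comm ε]
    rw [← hK _ _ ⟨H₀.resolvent f, hX (H₀.resolvent_mem_domain f)⟩
      ⟨H₀.resolvent h, hX (H₀.resolvent_mem_domain h)⟩]
    · exact hb₀ f h _ _ rfl rfl
    all_goals
      exact (H₀.resolventPow_comp_eq_resolvent (by norm_num) (by norm_num) (by norm_num) _).symm
  rw [← hN, epsNorm_le_coe_iff]
  intro φ ψ u v hu hv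
  obtain ⟨g, hg⟩ := H₀.mem_formDomain_iff.1 (hdom.le v.2)
  have hψ : ψ = H₀.resolventPow ε g := H₀.resolventPow_injective hm (by linarith [hε.1]) (by
    rw [← hv, ← hg, H₀.resolventPow_resolventPow hm hε.1, sub_add_cancel])
  rw [hψ, hK (H₀.resolventPow ε φ) g u v ?_ hg.symm]
  · exact hKb φ g
  · rw [hu, H₀.resolventPow_resolventPow (by norm_num) hε.1]

end Hamiltonian

/-! ### Extension to the form domain, and the operator bounded case -/

namespace Hamiltonian
variable {E : Type*} [NormedAddCommGroup E] [InnerProductSpace ℂ E] [CompleteSpace E]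
  {H₀ : Hamiltonian E} {X Y : SymmetricForm E}

/-- The form `(u, v) ↦ ⟨H₀ ^ (1/2) u, M H₀ ^ (1/2) v⟩` on `Q₀`, for a bounded self-adjoint `M`. -/
noncomputable def formOfOperator (H₀ : Hamiltonian E) (M : E →L[ℂ] E) (hM : IsSelfAdjoint M) :
    SymmetricForm E where
  domain := H₀.formDomain
  form := ((innerₛₗ ℂ).comp (H₀.pow (1 / 2)).toFun).compl₂ (M.toLinearMap ∘ₗ (H₀.pow (1 / 2)).toFun)
  symm u v := by
    change conj (inner ℂ (H₀.pow (1 / 2) u) (M (H₀.pow (1 / 2) v))) =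
      inner ℂ (H₀.pow (1 / 2) v) (M (H₀.pow (1 / 2) u))
    rw [inner_conj_symm]
    exact ContinuousLinearMap.isSelfAdjoint_iff_isSymmetric.1 hM _ _

theorem formOfOperator_form {M : E →L[ℂ] E} (hM : IsSelfAdjoint M) {f g : E}
    {u v : H₀.formDomain} (hu : (u : E) = H₀.resolventPow (1 / 2) f)
    (hv : (v : E) = H₀.resolventPow (1 / 2) g) :
    (H₀.formOfOperator M hM).form u v = inner ℂ f (M g) := by
  change inner ℂ (H₀.pow (1 / 2) u) (M (H₀.pow (1 / 2) v)) = _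
  rw [H₀.pow_half_apply hu, H₀.pow_half_apply hv]

theorem isFormBounded_formOfOperator {M : E →L[ℂ] E} (hM : IsSelfAdjoint M) :
    H₀.IsFormBounded (H₀.formOfOperator M hM) := by
  refine ⟨le_rfl, ‖M‖ + 1, by positivity, 1, one_pos, fun u => ?_⟩
  obtain ⟨f, hf⟩ := H₀.mem_formDomain_iff.1 u.2
  rw [H₀.quadForm_eq hf.symm]
  refine (congrArg norm (formOfOperator_form hM (u := u) (v := u) hf.symm hf.symm)).trans_le ?_
  calc _ ≤ ‖f‖ * (‖M‖ * ‖f‖) := (norm_inner_le_norm _ _).trans (by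
        gcongr; exact M.le_opNorm f)
    _ ≤ _ := by nlinarith [sq_nonneg ‖f‖, sq_nonneg ‖(u : E)‖]

/-- If `‖Y‖_0 < ∞` for a form with domain `D(H₀)`, then `Y` is given by a bounded operator on
`D(H₀ ^ (1/2))`, although only the vectors of the dense subspace `R₀ ^ (1/2) E` are tested. -/
theorem exists_isSelfAdjoint_form_eq_of_domain_eq (hY : Y.domain = H₀.op.domain)
    (h : H₀.epsNorm Y 0 < ∞) : ∃ M : E →L[ℂ] E, IsSelfAdjoint M ∧
      ∀ (f g : E) (u v : Y.domain), (u : E) = H₀.resolventPow (1 / 2) f →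
        (v : E) = H₀.resolventPow (1 / 2) g → Y.form u v = inner ℂ f (M g) := by
  obtain ⟨N, hN⟩ : ∃ N : ℝ≥0, N = H₀.epsNorm Y 0 := ⟨_, ENNReal.coe_toNNReal h.ne⟩
  have hb := epsNorm_zero_le_coe_iff.1 hN.ge
  have hhalf : ∀ f, H₀.resolventPow (1 / 2) (H₀.resolventPow (1 / 2) f) = H₀.resolvent f :=
    H₀.resolventPow_comp_eq_resolvent (by norm_num) (by norm_num) (by norm_num)
  have hmem : ∀ f, H₀.resolvent f ∈ Y.domain := fun f => hY ▸ H₀.resolvent_mem_domain f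
  have hdr : DenseRange (H₀.resolventPow (1 / 2)) :=
    H₀.denseRange_resolventPow (by norm_num) (by norm_num)
  let D : Submodule ℂ E := Y.domain.comap (H₀.resolventPow (1 / 2)).toLinearMap
  have hD : Dense (D : Set E) := hdr.mono (by
    rintro _ ⟨f, rfl⟩
    change H₀.resolventPow (1 / 2) (H₀.resolventPow (1 / 2) f) ∈ Y.domain
    rw [hhalf]; exact hmem f)
  obtain ⟨M, hM⟩ := exists_continuousLinearMap_inner_eq hD
    (e := (H₀.resolventPow (1 / 2)).toLinearMap) hdr
    ((Y.form.comp (H₀.resolvent.toLinearMap.codRestrict Y.domain hmem)).compl₂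
      ((H₀.resolventPow (1 / 2)).toLinearMap.restrict (p := D) (q := Y.domain) fun _ h => h)) N.2
    (fun f ψ => hb _ _ _ _ (hhalf f).symm rfl)
  have hMD : ∀ (f g : E) (u v : Y.domain), (u : E) = H₀.resolventPow (1 / 2) f →
        (v : E) = H₀.resolventPow (1 / 2) g → Y.form u v = inner ℂ (M f) g := by
    intro f g u v hu hv
    obtain ⟨w, hw⟩ : ∃ w, (u : E) = H₀.resolvent w :=
      ⟨H₀.op ⟨u, hY ▸ u.2⟩, (H₀.resolvent_op ⟨u, hY ▸ u.2⟩).symm⟩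
    have hf : f = H₀.resolventPow (1 / 2) w :=
      H₀.resolventPow_injective (s := 1 / 2) (by norm_num) (by norm_num) (by rw [← hu, hhalf, hw])
    have := hM w ⟨g, show _ ∈ Y.domain from hv ▸ v.2⟩
    rw [hf, show u = ⟨_, hmem w⟩ from Subtype.ext hw,
      show v = ⟨_, hv ▸ v.2⟩ from Subtype.ext hv]
    exact this
  have hsymm : ∀ f g, inner ℂ (M f) g = inner ℂ f (M g) := by
    intro f g
    refine hdr.induction_on₂ (p := fun f g => inner ℂ (M f) g = inner ℂ f (M g))
      (isClosed_eq (by fun_prop) (by fun_prop)) (fun f g => ?_) f g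
    have hf := (hhalf f).symm
    have hg := (hhalf g).symm
    rw [← hMD _ _ ⟨_, hmem f⟩ ⟨_, hmem g⟩ hf hg, ← Y.symm, hMD _ _ ⟨_, hmem g⟩ ⟨_, hmem f⟩ hg hf,
      inner_conj_symm]
  exact ⟨M, ContinuousLinearMap.isSelfAdjoint_iff_isSymmetric.2 hsymm,
    fun f g u v hu hv => by rw [hMD f g u v hu hv, hsymm]⟩

theorem epsNorm_restrict_zero_lt_top_iff (hX : H₀.op.domain ≤ X.domain) :
    H₀.epsNorm (X.restrict H₀.op.domain hX) 0 < ∞ ↔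
      ∃ (Y : SymmetricForm E) (hY : H₀.op.domain ≤ Y.domain), Y.domain = H₀.formDomain ∧
        H₀.IsFormBounded Y ∧ Y.restrict H₀.op.domain hY = X.restrict H₀.op.domain hX := by
  constructor
  · intro h
    obtain ⟨M, hM, hMX⟩ :=
      exists_isSelfAdjoint_form_eq_of_domain_eq (Y := X.restrict H₀.op.domain hX) rfl h
    refine ⟨H₀.formOfOperator M hM, H₀.domain_le_formDomain, rfl,
      isFormBounded_formOfOperator hM, ?_⟩
    have hform : ((H₀.formOfOperator M hM).restrict H₀.op.domain H₀.domain_le_formDomain).form =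
        (X.restrict H₀.op.domain hX).form := by
      refine LinearMap.ext fun u => LinearMap.ext fun v => ?_
      obtain ⟨f, hf⟩ := H₀.mem_formDomain_iff.1 (H₀.domain_le_formDomain u.2)
      obtain ⟨g, hg⟩ := H₀.mem_formDomain_iff.1 (H₀.domain_le_formDomain v.2)
      exact (formOfOperator_form hM hf.symm hg.symm).trans (hMX f g u v hf.symm hg.symm).symm
    simp only [SymmetricForm.restrict] at hform ⊢
    congr 1
  · rintro ⟨Y, hY, -, hb, heq⟩
    rw [← heq]
    exact (epsNorm_restrict_le hY 0).trans_lt hb.epsNorm_zero_lt_top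

/-- At `ε = 1/2` the second power is `R₀ ^ 0 = 1`, so the second argument is any unit vector of
`Q(X)`. -/
theorem epsNorm_half_le_iff {N : ℝ≥0∞} : H₀.epsNorm X (1 / 2) ≤ N ↔
    ∀ (f : E) (u v : X.domain), (u : E) = H₀.resolvent f → ‖f‖ ≤ 1 → ‖(v : E)‖ ≤ 1 →
      ‖X.form u v‖ₑ ≤ N := by
  rw [epsNorm_le_iff, add_halves, sub_self, resolventPow_one]
  simp only [resolventPow_zero]
  exact ⟨fun h f u v hu hf hv => h f v u v hu rfl hf hv,
    fun h f ψ u v hu hv hf hψ => h f u v hu hf (hv ▸ hψ)⟩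

theorem epsNorm_half_le_coe_iff {N : ℝ≥0} : H₀.epsNorm X (1 / 2) ≤ N ↔
    ∀ (f : E) (u v : X.domain), (u : E) = H₀.resolvent f → ‖X.form u v‖ ≤ N * ‖f‖ * ‖(v : E)‖ := by
  rw [epsNorm_le_coe_iff, add_halves, sub_self, resolventPow_one]
  simp only [resolventPow_zero]
  exact ⟨fun h f u v hu => h f v u v hu rfl, fun h f ψ u v hu hv => hv ▸ h f u v hu⟩

theorem epsNorm_restrict_half_eq (hX : H₀.op.domain ≤ X.domain) (T : H₀.op.domain →ₗ[ℂ] E)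
    (hT : ∀ u v : H₀.op.domain,
      X.form (Submodule.inclusion hX u) (Submodule.inclusion hX v) = inner ℂ (T u) (v : E)) :
    H₀.epsNorm (X.restrict H₀.op.domain hX) (1 / 2) =
      ⨆ (f : E) (_ : ‖f‖ ≤ 1) (u : H₀.op.domain) (_ : (u : E) = H₀.resolvent f), ‖T u‖ₑ := by
  apply le_antisymm
  · refine epsNorm_half_le_iff.2 fun f u v hu hf hv => ?_
    refine le_trans ?_ (le_iSup₂_of_le f hf (le_iSup₂_of_le u hu le_rfl))
    rw [← ofReal_norm, ← ofReal_norm]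
    refine ENNReal.ofReal_le_ofReal ?_
    exact (congrArg norm (hT u v)).trans_le
      ((norm_inner_le_norm _ _).trans (mul_le_of_le_one_right (norm_nonneg _) hv))
  · rcases eq_or_ne (H₀.epsNorm (X.restrict H₀.op.domain hX) (1 / 2)) ∞ with htop | htop
    · rw [htop]; exact le_top
    obtain ⟨N, hN⟩ : ∃ N : ℝ≥0, N = H₀.epsNorm (X.restrict H₀.op.domain hX) (1 / 2) :=
      ⟨_, ENNReal.coe_toNNReal htop⟩
    rw [← hN]
    refine iSup₂_le fun f hf => iSup₂_le fun u hu => ?_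
    rw [← ofReal_norm, ENNReal.ofReal_le_iff_le_toReal ENNReal.coe_ne_top, ENNReal.coe_toReal]
    refine norm_le_of_forall_mem_norm_inner_le H₀.isSelfAdjoint.dense_domain N.2 fun v hv => ?_
    rw [norm_inner_symm, ← hT u ⟨v, hv⟩]
    refine (epsNorm_half_le_coe_iff.1 hN.ge f u ⟨v, hv⟩ hu).trans ?_
    exact mul_le_mul_of_nonneg_right (mul_le_of_le_one_right N.2 hf) (norm_nonneg v)

theorem epsNorm_restrict_half_lt_top_iff (hX : H₀.op.domain ≤ X.domain) :
    H₀.epsNorm (X.restrict H₀.op.domain hX) (1 / 2) < ∞ ↔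
      ∃ T : H₀.op.domain →ₗ[ℂ] E, H₀.IsOperatorBounded ⟨H₀.op.domain, T⟩ ∧
        ∀ u v : H₀.op.domain,
          X.form (Submodule.inclusion hX u) (Submodule.inclusion hX v) =
            inner ℂ (T u) (v : E) := by
  constructor
  · intro h
    obtain ⟨N, hN⟩ : ∃ N : ℝ≥0, N = H₀.epsNorm (X.restrict H₀.op.domain hX) (1 / 2) :=
      ⟨_, ENNReal.coe_toNNReal h.ne⟩
    have hb : ∀ u v : H₀.op.domain, ‖(X.restrict H₀.op.domain hX).form u v‖ ≤
        N * ‖H₀.op u‖ * ‖(v : E)‖ := fun u v =>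
      epsNorm_half_le_coe_iff.1 hN.ge (H₀.op u) u v (H₀.resolvent_op u).symm
    obtain ⟨T, hT⟩ := exists_linearMap_inner_eq H₀.isSelfAdjoint.dense_domain
      (X.restrict H₀.op.domain hX).form fun u => ⟨_, hb u⟩
    refine ⟨T, ⟨le_rfl, N + 1, by positivity, 1, one_pos, fun u => ?_⟩, hT⟩
    have hTu : ‖T u‖ ≤ N * ‖H₀.op u‖ := by
      refine norm_le_of_forall_mem_norm_inner_le H₀.isSelfAdjoint.dense_domain (by positivity)
        fun v hv => ?_
      rw [norm_inner_symm, ← hT u ⟨v, hv⟩]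
      exact hb u ⟨v, hv⟩
    change ‖T u‖ ≤ _
    linarith [norm_nonneg (u : E), norm_nonneg (H₀.op u)]
  · rintro ⟨T, ⟨_, a, ha, b, hb, h⟩, hT⟩
    rw [epsNorm_restrict_half_eq hX T hT]
    refine lt_of_le_of_lt (b := ENNReal.ofReal (a + b)) ?_ ENNReal.ofReal_lt_top
    refine iSup₂_le fun f hf => iSup₂_le fun u hu => ?_
    rw [← ofReal_norm]
    refine ENNReal.ofReal_le_ofReal ((h u).trans ?_)
    have hop : ‖H₀.op u‖ ≤ 1 := by
      rwa [H₀.resolvent_injective ((H₀.resolvent_op u).trans hu)]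
    calc a * ‖H₀.op u‖ + b * ‖(u : E)‖ ≤ a * 1 + b * 1 := by
          gcongr
          exact (H₀.norm_le u).trans hop
      _ = a + b := by ring

end Hamiltonian

end

theorem lemma2 {E : Type*} [NormedAddCommGroup E] [InnerProductSpace ℂ E] [CompleteSpace E]
    (H₀ : Hamiltonian E) (X : SymmetricForm E) (hX : H₀.op.domain ≤ X.domain) :
    -- a form (or operator) with domain `D(H₀)`: monotone, with values in `[0, ∞]`
    MonotoneOn (H₀.epsNorm (X.restrict H₀.op.domain hX)) (Set.Icc 0 (1 / 2)) ∧
    -- a form with domain `Q₀` that is `q₀`-bounded: monotone, with values in `[0, ∞]`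
    (X.domain = H₀.formDomain → H₀.IsFormBounded X →
      MonotoneOn (H₀.epsNorm X) (Set.Icc 0 (1 / 2))) ∧
    -- a form with any larger domain: monotone where it is finite
    MonotoneOn (H₀.epsNorm X) {ε ∈ Set.Icc 0 (1 / 2) | H₀.epsNorm X ε < ∞} ∧
    -- and there it agrees with the norm of the restriction to `D(H₀)`
    (∀ ε ∈ Set.Icc (0 : ℝ) (1 / 2), H₀.epsNorm X ε < ∞ →
      H₀.epsNorm X ε = H₀.epsNorm (X.restrict H₀.op.domain hX) ε) ∧
    -- `ε = 0` is the form bounded case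
    (H₀.formDomain ≤ X.domain → (H₀.epsNorm X 0 < ∞ ↔ H₀.IsFormBounded X)) ∧
    (H₀.epsNorm (X.restrict H₀.op.domain hX) 0 < ∞ ↔
      ∃ (Y : SymmetricForm E) (hY : H₀.op.domain ≤ Y.domain), Y.domain = H₀.formDomain ∧
        H₀.IsFormBounded Y ∧ Y.restrict H₀.op.domain hY = X.restrict H₀.op.domain hX) ∧
    -- `ε = 1/2` is the operator bounded case
    (H₀.epsNorm (X.restrict H₀.op.domain hX) (1 / 2) < ∞ ↔
      ∃ T : H₀.op.domain →ₗ[ℂ] E, H₀.IsOperatorBounded ⟨H₀.op.domain, T⟩ ∧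
        ∀ u v : H₀.op.domain,
          X.form (Submodule.inclusion hX u) (Submodule.inclusion hX v) = inner ℂ (T u) (v : E)) ∧
    (∀ T : H₀.op.domain →ₗ[ℂ] E,
      (∀ u v : H₀.op.domain,
        X.form (Submodule.inclusion hX u) (Submodule.inclusion hX v) = inner ℂ (T u) (v : E)) →
      H₀.epsNorm (X.restrict H₀.op.domain hX) (1 / 2) =
        ⨆ (f : E) (_ : ‖f‖ ≤ 1) (u : H₀.op.domain) (_ : (u : E) = H₀.resolvent f), ‖T u‖ₑ) := by
  refine ⟨Hamiltonian.monotoneOn_epsNorm_of_domain_eq rfl, fun hdom hb => ?_,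
    fun s hs t ht hst => ?_,
    fun ε hε h => Hamiltonian.epsNorm_eq_epsNorm_restrict hX hε h,
    Hamiltonian.epsNorm_zero_lt_top_iff, Hamiltonian.epsNorm_restrict_zero_lt_top_iff hX,
    Hamiltonian.epsNorm_restrict_half_lt_top_iff hX, Hamiltonian.epsNorm_restrict_half_eq hX⟩
  · exact (Hamiltonian.monotoneOn_epsNorm_of_domain_eq
      (Y := X.restrict H₀.op.domain hX) rfl).congr fun ε hε =>
        (Hamiltonian.epsNorm_restrict_le hX ε).antisymm
          (Hamiltonian.epsNorm_le_epsNorm_restrict_of_isFormBounded hX hdom hb hε)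
  · rw [Hamiltonian.epsNorm_eq_epsNorm_restrict hX hs.1 hs.2,
      Hamiltonian.epsNorm_eq_epsNorm_restrict hX ht.1 ht.2]
    exact Hamiltonian.monotoneOn_epsNorm_of_domain_eq
      (Y := X.restrict H₀.op.domain hX) rfl hs.1 ht.1 hst
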